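/- All graphs are finite and simple. A *source* of a DAG is a vertex of indegree $0$. A *DAG elimination forest* of a DAG $\vec H$ is a rooted forest built recursively: the empty DAG has the empty forest; a DAG with exactly one source has the one-node tree; if the underlying undirected graph is disconnected, take the union of elimination forests of its connected components; otherwise choose a source $s$, delete $s$ and all vertices reachable from it, and take the tree with root $s$ whose subtrees are the trees of an elimination forest of the remaining DAG. The depth of a forest is the largest number of nodes on a root-to-leaf path. The DAG treedepth of $\vec H$ is the minimum depth of its elimination forests, and the DAG treedepth $\mathrm{dtd}(H)$ of an undirected graph $H$ is the maximum of the DAG treedepths of its acyclic orientations. A graph is *$d$-degenerate* if every nonempty subgraph has a vertex of degree at most $d$. **Theorem.** Let $d$ and $k$ be fixed. There are constants $C,s,c$, depending only on $d$ and $k$, such that for every $k$-vertex graph $H$ with $\mathrm{dtd}(H)=t$ there is a program for the unit-cost RAM (with addition, truncated subtraction, multiplication, indirect addressing, conditional jumps and a read-only input array) with the following property. For every $n$, every $d$-degenerate graph $G$ on $\{0,\dots,n-1\}$ has an acyclic orientation with all outdegrees at most $d$, and whenever $G$ is given by $n$ and the out-neighbour lists of any such orientation, in any order, the program halts after at most $C\,(n^t+1)$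 steps and outputs the number $\hom(H,G)$ of homomorphisms from $H$ to $G$, uses at most $s$ cells of working memory, and never stores a number larger than $(n+2)^c$. In short, homomorphisms from $H$ to an $n$-vertex $d$-degenerate host can be counted in $O(n^t)$ time and constant space. -/

import Mathlib

/-! ### Degenerate graphs -/

/-- `G` is `d`-degenerate: every (nonempty) subgraph has a vertex of degree at most `d`. -/
def IsDegenerate {V : Type*} [Finite V] (G : SimpleGraph V) (d : ℕ) : Prop :=
  ∀ K : G.Subgraph, K.verts.Nonempty → ∃ v ∈ K.verts, (K.neighborSet v).ncard ≤ d

/-! ### Acyclic orientations and DAG treedepth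

A directed graph on `V` is a relation `E`, with `E u v` for an arc `u → v`. A sub-DAG that occurs in
the recursion is the one induced on a set `S` of vertices. -/

/-- No directed cycle. -/
def IsAcyclicRel {V : Type*} (E : V → V → Prop) : Prop :=
  ∀ v, ¬ Relation.TransGen E v v

/-- `E` is an acyclic orientation of the simple graph `H`. An edge cannot receive both directions,
since these would form a directed cycle. -/
def IsAcyclicOrientation {V : Type*} (H : SimpleGraph V) (E : V → V → Prop) : Prop :=
  (∀ u v, H.Adj u v ↔ E u v ∨ E v u) ∧ IsAcyclicRel E

/-- `s` is a source (a vertex of indegree zero) of the digraph induced by `E` on `S`. -/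
def IsSourceIn {V : Type*} (E : V → V → Prop) (S : Set V) (s : V) : Prop :=
  s ∈ S ∧ ∀ u ∈ S, ¬ E u s

/-- The vertices reachable from `s` (including `s`) in the digraph induced by `E` on `S`. -/
def reachIn {V : Type*} (E : V → V → Prop) (S : Set V) (s : V) : Set V :=
  {v | Relation.ReflTransGen (fun a b => a ∈ S ∧ b ∈ S ∧ E a b) s v}

/-- The underlying undirected graph of the digraph induced by `E` on `S`. -/
def underlyingIn {V : Type*} (E : V → V → Prop) (S : Set V) : SimpleGraph S :=
  (SimpleGraph.fromRel E).induce S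

/-- The vertex set, as a set of vertices of the ambient digraph, of a connected component. -/
def componentIn {V : Type*} (E : V → V → Prop) (S : Set V)
    (c : (underlyingIn E S).ConnectedComponent) : Set V :=
  Subtype.val '' c.supp

/-- `HasElimForest E S m`: the digraph induced by `E` on `S` has a DAG elimination forest of depth
at most `m`, the depth being the largest number of nodes on a path from a root to a leaf. -/
inductive HasElimForest {V : Type*} (E : V → V → Prop) : Set V → ℕ → Prop
  /-- The empty digraph has the empty forest. -/
  | empty (m : ℕ) : HasElimForest E ∅ m
  /-- A digraph with exactly one source has the forest with a single node. -/
  | single (S : Set V) (s : V) (m : ℕ) :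
      IsSourceIn E S s → (∀ s', IsSourceIn E S s' → s' = s) → HasElimForest E S (m + 1)
  /-- For a disconnected digraph take the union of forests of the connected components. -/
  | disconnected (S : Set V) (m : ℕ) :
      ¬ (underlyingIn E S).Preconnected →
      (∀ c : (underlyingIn E S).ConnectedComponent, HasElimForest E (componentIn E S c) m) →
      HasElimForest E S m
  /-- For a connected digraph with at least two sources take some source `s` as root, above a
  forest of what is left after deletion of `s` and all vertices reachable from it. -/
  | root (S : Set V) (s : V) (m : ℕ) :
      (underlyingIn E S).Connected → IsSourceIn E S s → (∃ s', IsSourceIn E S s' ∧ s' ≠ s) →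
      HasElimForest E (S \ reachIn E S s) m →
      HasElimForest E S (m + 1)

/-- The DAG treedepth of a DAG: the minimum depth of a DAG elimination forest. -/
noncomputable def dagTreedepthOfDag {V : Type*} (E : V → V → Prop) : ℕ :=
  sInf {m | HasElimForest E Set.univ m}

/-- The DAG treedepth of an undirected finite graph: the maximum of the DAG treedepths of its
acyclic orientations. -/
noncomputable def dagTreedepth {V : Type*} [Finite V] (H : SimpleGraph V) : ℕ :=
  sSup {t | ∃ E : V → V → Prop, IsAcyclicOrientation H E ∧ t = dagTreedepthOfDag E}

/-! ### The unit-cost RAM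

The working memory is an array of cells `M[0], M[1], …` of natural numbers. The input is a separate
read-only array of words. -/

/-- The instructions. -/
inductive RamInstr
  /-- `M[a] := c` -/
  | const (a c : ℕ)
  /-- `M[a] := M[b] + M[c]` -/
  | add (a b c : ℕ)
  /-- `M[a] := M[b] - M[c]`, or `0` if that is negative -/
  | sub (a b c : ℕ)
  /-- `M[a] := M[b] * M[c]` -/
  | mul (a b c : ℕ)
  /-- `M[a] := M[M[b]]` -/
  | load (a b : ℕ)
  /-- `M[M[a]] := M[b]` -/
  | store (a b : ℕ)
  /-- `M[a] := ` the input word with index `M[b]` -/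
  | read (a b : ℕ)
  /-- jump to instruction `l` if `M[a] = 0` -/
  | jumpZero (a l : ℕ)

/-- A program is a finite list of instructions. It halts when it leaves the list. -/
abbrev RamProgram := List RamInstr

/-- A configuration: the program counter and the contents of the working memory. -/
structure RamState where
  pc : ℕ
  mem : ℕ → ℕ

/-- The effect of a single instruction on input `w`. -/
def RamInstr.exec (w : ℕ → ℕ) (σ : RamState) : RamInstr → RamState
  | .const a c => ⟨σ.pc + 1, Function.update σ.mem a c⟩
  | .add a b c => ⟨σ.pc + 1, Function.update σ.mem a (σ.mem b + σ.mem c)⟩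
  | .sub a b c => ⟨σ.pc + 1, Function.update σ.mem a (σ.mem b - σ.mem c)⟩
  | .mul a b c => ⟨σ.pc + 1, Function.update σ.mem a (σ.mem b * σ.mem c)⟩
  | .load a b => ⟨σ.pc + 1, Function.update σ.mem a (σ.mem (σ.mem b))⟩
  | .store a b => ⟨σ.pc + 1, Function.update σ.mem (σ.mem a) (σ.mem b)⟩
  | .read a b => ⟨σ.pc + 1, Function.update σ.mem a (w (σ.mem b))⟩
  | .jumpZero a l => ⟨if σ.mem a = 0 then l else σ.pc + 1, σ.mem⟩

/-- One step of program `P` on input `w`; a halted machine does not move. -/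
def ramStep (P : RamProgram) (w : ℕ → ℕ) (σ : RamState) : RamState :=
  match P[σ.pc]? with
  | some i => i.exec w σ
  | none => σ

/-- The configuration after `i` steps, from the start with all cells of the working memory `0`. -/
def ramRun (P : RamProgram) (w : ℕ → ℕ) (i : ℕ) : RamState :=
  (ramStep P w)^[i] ⟨0, fun _ => 0⟩

/-- Program `P` on input `w` halts after at most `T` steps with result `r` in `M[0]`, it never
stores anything outside the `s` cells `M[0], …, M[s-1]`, and no cell ever holds a number larger
than `B`. -/
def RamComputes (P : RamProgram) (w : ℕ → ℕ) (T s B r : ℕ) : Prop :=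
  P.length ≤ (ramRun P w T).pc ∧
  (ramRun P w T).mem 0 = r ∧
  ∀ i a, (ramRun P w i).mem a ≤ B ∧ (s ≤ a → (ramRun P w i).mem a = 0)

/-! ### The representation of the host graph -/

/-- A representation of a `d`-degenerate graph on the vertices `0, …, n-1` by the out-neighbour
lists of an acyclic orientation in which every outdegree is at most `d`. The lists, the order within
each list and the underlying acyclic orientation are arbitrary. -/
structure HostLists {n : ℕ} (G : SimpleGraph (Fin n)) (d : ℕ) where
  out : Fin n → List (Fin n)
  nodup : ∀ v, (out v).Nodup
  length_le : ∀ v, (out v).length ≤ d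
  orientation : IsAcyclicOrientation G (fun u v => v ∈ out u)

/-- The words of the input array. Word `0` is the number `n` of vertices. It is followed by one
block of `d + 1` words for each vertex `v`: the outdegree of `v`, then its out-neighbours, then
zeros. -/
def HostLists.words {n : ℕ} {G : SimpleGraph (Fin n)} {d : ℕ} (X : HostLists G d) : ℕ → ℕ
  | 0 => n
  | i + 1 =>
    if h : i / (d + 1) < n then
      match i % (d + 1) with
      | 0 => (X.out ⟨i / (d + 1), h⟩).length
      | j + 1 => ((X.out ⟨i / (d + 1), h⟩).map Fin.val).getD j 0
    else 0

/-! ### Expressions over a read-only array, and their compilation to the RAM -/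

/-! A homomorphism from H to G pulls the given acyclic orientation of G back to exactly one acyclic
orientation of H (`sum_keptInd_eq`). Hence hom(H,G) is the sum, over the finitely many acyclic
orientations E of H, of the number of arc-preserving maps from E to the oriented host.

For fixed E these maps are counted along an elimination forest. The image of a root s ranges over n
vertices. Every other vertex reachable from s can be placed when it is the head of an arc whose tail
already has an image, which leaves at most d candidates; so only roots cost a loop of length n.
Components of a disconnected remainder contribute independent factors, so loops nest only along
root-to-leaf paths and the nesting depth is at most t.

The recursion closes because `extCount` charges to a set S all arcs with tail in S, wherever their
heads lie. If R is the set reachable from s, no arc leads from R to S \ R: the arcs charged to R are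
settled once R is placed, and arcs from S \ R into R are checked later against fixed images
(`extCount_union`, `exists_expr_of_partial_reach`, `HasElimForest.exists_expr`).

The resulting formula depends only on H and d. `CountExpr.compile_correct` turns it into a program
in which sums are loops and intermediate values form a stack of fixed height, so no table is ever
stored. -/

/-- The binary arithmetic operations of the RAM. -/
inductive ArithOp
  | add
  | sub
  | mul

namespace ArithOp

/-- The value of an operation on natural numbers. -/
def apply : ArithOp → ℕ → ℕ → ℕ
  | add, x, y => x + y
  | sub, x, y => x - y
  | mul, x, y => x * y

/-- The instruction that performs an operation. -/
def instr : ArithOp → ℕ → ℕ → ℕ → RamInstr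
  | add => .add
  | sub => .sub
  | mul => .mul

theorem exec_instr (o : ArithOp) (w : ℕ → ℕ) (p : ℕ) (m : ℕ → ℕ) (a b c : ℕ) :
    (o.instr a b c).exec w ⟨p, m⟩ = ⟨p + 1, Function.update m a (o.apply (m b) (m c))⟩ := by
  cases o <;> rfl

theorem apply_le {N x y g h : ℕ} (hN : 2 ≤ N) (o : ArithOp) (hx : x ≤ N ^ g) (hy : y ≤ N ^ h) :
    o.apply x y ≤ N ^ (g + h + 1) := by
  have hg : N ^ g ≤ N ^ (g + h) := Nat.pow_le_pow_right (by omega) (by omega)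
  have hh : N ^ h ≤ N ^ (g + h) := Nat.pow_le_pow_right (by omega) (by omega)
  have h2 : N ^ (g + h) * 2 ≤ N ^ (g + h + 1) := by
    rw [pow_succ]; exact Nat.mul_le_mul_left _ hN
  cases o
  · simp only [apply]; omega
  · simp only [apply]; omega
  · simp only [apply]
    have : x * y ≤ N ^ (g + h) := by rw [pow_add]; exact Nat.mul_le_mul hx hy
    omega

end ArithOp

/-- Arithmetic expressions in variables from `V` over an input array `w`. -/
inductive CountExpr (V : Type) : Type
  /-- a constant -/
  | const (c : ℕ)
  /-- the value of a variable -/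
  | var (v : V)
  /-- an arithmetic operation -/
  | op (o : ArithOp) (e f : CountExpr V)
  /-- the input word whose index is the value of `e` -/
  | read (e : CountExpr V)
  /-- the value of `f` with `v` bound to the value of `e` -/
  | bind (v : V) (e f : CountExpr V)
  /-- the sum of the values of `e` with `v` ranging over the numbers below `w 0` -/
  | sum (v : V) (e : CountExpr V)

namespace CountExpr

variable {V : Type}

/-- The value of an expression. -/
def eval [DecidableEq V] (w : ℕ → ℕ) : CountExpr V → (V → ℕ) → ℕ
  | const c, _ => c
  | var v, φ => φ v
  | op o e f, φ => o.apply (e.eval w φ) (f.eval w φ)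
  | read e, φ => w (e.eval w φ)
  | bind v e f, φ => f.eval w (Function.update φ v (e.eval w φ))
  | sum v e, φ => ∑ x ∈ Finset.range (w 0), e.eval w (Function.update φ v x)

/-- The nesting depth of sums. -/
def depth : CountExpr V → ℕ
  | const _ => 0
  | var _ => 0
  | op _ e f => max e.depth f.depth
  | read e => e.depth
  | bind _ e f => max e.depth f.depth
  | sum _ e => e.depth + 1

/-- The code for an expression, placed at position `p`. Variable `v` is found in cell `ρ v`, the
value is left in cell `b`, and only cells from `b` on are written. -/
def compile [DecidableEq V] : CountExpr V → (V → ℕ) → ℕ → ℕ → RamProgram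
  | const c, _, b, _ => [.const b c]
  | var v, ρ, b, _ => [.const b 0, .add b b (ρ v)]
  | op o e f, ρ, b, p =>
    e.compile ρ b p ++ (f.compile ρ (b + 1) (p + (e.compile ρ b p).length) ++
      [o.instr b b (b + 1)])
  | read e, ρ, b, p => e.compile ρ b p ++ [.read b b]
  | bind v e f, ρ, b, p =>
    e.compile ρ b p ++
      (f.compile (Function.update ρ v b) (b + 1) (p + (e.compile ρ b p).length) ++
        [.const b 0, .add b b (b + 1)])
  | sum v e, ρ, b, p =>
    -- Cell `b` accumulates the sum, `b + 1` is both the loop counter and the home of `v`, and `b +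
    -- 2` is scratch space and receives the value of the body. The zero in `b` first serves as the
    -- index of the input word that holds `n`.
    .const b 0 :: .read (b + 1) b ::
      .jumpZero (b + 1)
        (p + 5 + (e.compile (Function.update ρ v (b + 1)) (b + 2) (p + 5)).length + 3) ::
      .const (b + 2) 1 :: .sub (b + 1) (b + 1) (b + 2) ::
      (e.compile (Function.update ρ v (b + 1)) (b + 2) (p + 5) ++
        [.add b b (b + 2), .const (b + 2) 0, .jumpZero (b + 2) (p + 2)])

/-- The number of steps taken by the code, for `w 0 = n`. -/
def time (n : ℕ) : CountExpr V → ℕ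
  | const _ => 1
  | var _ => 2
  | op _ e f => e.time n + (f.time n + 1)
  | read e => e.time n + 1
  | bind _ e f => e.time n + (f.time n + 2)
  -- Two steps of setup; six per round besides the body (test, two for the decrement, addition, two
  -- for the jump back); one final test.
  | sum _ e => 2 + (n * (e.time n + 6) + 1)

/-- The number of cells used by the code. -/
def cells : CountExpr V → ℕ
  | const _ => 1
  | var _ => 1
  | op _ e f => e.cells + f.cells + 2
  | read e => e.cells + 1
  | bind _ e f => e.cells + f.cells + 2
  | sum _ e => e.cells + 3

/-- An exponent bounding the value of an expression, when `a` is an exponent that bounds the values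
of the variables and of the input words. -/
def growth : CountExpr V → ℕ → ℕ
  -- The exponent `c` suffices since `c ≤ 2 ^ c`; adding `a` ensures `le_growth`.
  | const c, a => c + a
  | var _, a => a
  | op _ e f, a => e.growth a + f.growth a + 1
  | read e, a => e.growth a
  | bind _ e f, a => f.growth (e.growth a)
  | sum _ e, a => e.growth a + 1

theorem le_growth (e : CountExpr V) (a : ℕ) : a ≤ e.growth a := by
  induction e generalizing a with
  | const c => simp [growth]
  | var v => simp [growth]
  | op o e f he hf => have := he a; simp only [growth]; omega
  | read e he => exact he a
  | bind v e f he hf => exact (he a).trans (hf _)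
  | sum v e he => have := he a; simp only [growth]; omega

theorem update_le [DecidableEq V] {φ : V → ℕ} {N : ℕ} (hφ : ∀ v, φ v ≤ N) (v : V) {x : ℕ} (hx : x ≤ N) (u : V) :
    Function.update φ v x u ≤ N := by
  by_cases h : u = v
  · subst h; simpa
  · simpa [h] using hφ u

theorem eval_le [DecidableEq V] {w : ℕ → ℕ} (e : CountExpr V) {a : ℕ} {φ : V → ℕ}
    (hw : ∀ i, w i ≤ (w 0 + 2) ^ a) (hφ : ∀ v, φ v ≤ (w 0 + 2) ^ a) :
    e.eval w φ ≤ (w 0 + 2) ^ e.growth a := by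
  have mono : ∀ {g h : ℕ}, g ≤ h → (w 0 + 2) ^ g ≤ (w 0 + 2) ^ h :=
    fun h => Nat.pow_le_pow_right (by omega) h
  induction e generalizing a φ with
  | const c =>
    calc c ≤ 2 ^ c := Nat.lt_two_pow_self.le
      _ ≤ (w 0 + 2) ^ c := Nat.pow_le_pow_left (by omega) c
      _ ≤ _ := mono (Nat.le_add_right c a)
  | var v => exact hφ v
  | op o e f he hf => exact o.apply_le (by omega) (he hw hφ) (hf hw hφ)
  | read e he => exact (hw _).trans (mono (e.le_growth a))
  | bind v e f he hf =>
    -- All bounds are relaxed to the exponent `e.growth a`, which also covers the newly bound value.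
    have hm := mono (e.le_growth a)
    exact hf (fun i => (hw i).trans hm)
      (update_le (fun u => (hφ u).trans hm) v (he hw hφ))
  | sum v e he =>
    simp only [eval, growth]
    calc ∑ x ∈ Finset.range (w 0), e.eval w (Function.update φ v x)
        ≤ ∑ x ∈ Finset.range (w 0), (w 0 + 2) ^ e.growth a := by
          refine Finset.sum_le_sum fun x hx => he hw (update_le hφ v ?_)
          exact (Finset.mem_range.mp hx).le.trans (hw 0)
      _ = w 0 * (w 0 + 2) ^ e.growth a := by simp
      _ ≤ _ := by rw [pow_succ, mul_comm]; exact Nat.mul_le_mul_left _ (by omega)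

/-- Each level of summation multiplies the time by `n`, up to constants. Allowing every `t` above
the depth lets subexpressions of different depths be compared with the same power. -/
theorem exists_time_le (e : CountExpr V) :
    ∃ C, ∀ n t, e.depth ≤ t → e.time n ≤ C * (n ^ t + 1) := by
  induction e with
  | const c => exact ⟨1, fun n t _ => by simp [time]⟩
  | var v => exact ⟨2, fun n t _ => by simp only [time]; omega⟩
  | op o e f he hf =>
    obtain ⟨C, hC⟩ := he
    obtain ⟨D, hD⟩ := hf
    refine ⟨C + D + 1, fun n t h => ?_⟩
    have h1 := hC n t ((le_max_left _ _).trans h)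
    have h2 := hD n t ((le_max_right _ _).trans h)
    simp only [time, add_mul]; omega
  | read e he =>
    obtain ⟨C, hC⟩ := he
    refine ⟨C + 1, fun n t h => ?_⟩
    have h1 := hC n t h
    simp only [time, add_mul]; omega
  | bind v e f he hf =>
    obtain ⟨C, hC⟩ := he
    obtain ⟨D, hD⟩ := hf
    refine ⟨C + D + 2, fun n t h => ?_⟩
    have h1 := hC n t ((le_max_left _ _).trans h)
    have h2 := hD n t ((le_max_right _ _).trans h)
    simp only [time, add_mul]; omega
  | sum v e he =>
    obtain ⟨C, hC⟩ := he
    -- Since `n ≤ n ^ (t + 1)`, the bodies cost at most `2 * C * n ^ (t + 1)`; the rest is `6 * n +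
    -- 3`.
    refine ⟨2 * C + 9, fun n t h => ?_⟩
    simp only [depth] at h
    obtain ⟨t, rfl⟩ : ∃ r, t = r + 1 := ⟨t - 1, by omega⟩
    have h1 := hC n t (by omega)
    have h2 : n ≤ n ^ (t + 1) := Nat.le_self_pow (by omega) n
    have h3 : n * e.time n ≤ n * (C * (n ^ t + 1)) := Nat.mul_le_mul_left _ h1
    have h4 : n * (C * (n ^ t + 1)) = C * (n ^ (t + 1) + n) := by ring
    have h5 : C * (n ^ (t + 1) + n) ≤ C * (n ^ (t + 1) + n ^ (t + 1)) :=
      Nat.mul_le_mul_left _ (by omega)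
    simp only [time]
    nlinarith

end CountExpr

/-! ### Runs of the RAM -/

/-- No cell of the memory holds a number larger than `B`, and the cells from `s` on are zero. -/
def TameMem (B s : ℕ) (m : ℕ → ℕ) : Prop :=
  ∀ a, m a ≤ B ∧ (s ≤ a → m a = 0)

theorem TameMem.update {B s : ℕ} {m : ℕ → ℕ} (h : TameMem B s m) {a x : ℕ} (ha : a < s)
    (hx : x ≤ B) : TameMem B s (Function.update m a x) := by
  intro c
  by_cases hc : c = a
  · subst hc; simpa [hx] using fun h : s ≤ c => absurd h (by omega)
  · simpa [hc] using h c

/-- `P` takes `σ` to `τ` in `T` steps, with tame memory all the time. -/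
def Reaches (P : RamProgram) (w : ℕ → ℕ) (B s T : ℕ) (σ τ : RamState) : Prop :=
  (ramStep P w)^[T] σ = τ ∧ ∀ i ≤ T, TameMem B s ((ramStep P w)^[i] σ).mem

namespace Reaches

variable {P : RamProgram} {w : ℕ → ℕ} {B s T U : ℕ} {σ τ υ : RamState}

theorem refl (h : TameMem B s σ.mem) : Reaches P w B s 0 σ σ :=
  ⟨rfl, fun i hi => by obtain rfl : i = 0 := by omega
                       exact h⟩

theorem tame {p : ℕ} {m : ℕ → ℕ} (h : Reaches P w B s T σ ⟨p, m⟩) : TameMem B s m := by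
  have := h.2 T le_rfl
  rwa [h.1] at this

theorem trans (h : Reaches P w B s T σ τ) (h' : Reaches P w B s U τ υ) :
    Reaches P w B s (T + U) σ υ := by
  refine ⟨by rw [Nat.add_comm, Function.iterate_add_apply, h.1, h'.1], fun i hi => ?_⟩
  by_cases hT : i ≤ T
  · exact h.2 i hT
  · obtain ⟨j, rfl⟩ : ∃ j, i = j + T := ⟨i - T, by omega⟩
    rw [Function.iterate_add_apply, h.1]
    exact h'.2 j (by omega)

theorem step {i : RamInstr} (hi : P[σ.pc]? = some i) (he : i.exec w σ = τ)
    (hσ : TameMem B s σ.mem) (hτ : TameMem B s τ.mem) : Reaches P w B s 1 σ τ := by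
  have hs : ramStep P w σ = τ := by simp only [ramStep, hi, he]
  refine ⟨hs, fun j hj => ?_⟩
  obtain rfl | rfl : j = 0 ∨ j = 1 := by omega
  · exact hσ
  · simpa [hs] using hτ

/-- A single step that writes a cell. -/
theorem write {i : RamInstr} {p a x : ℕ} {m : ℕ → ℕ} (hi : P[p]? = some i)
    (he : i.exec w ⟨p, m⟩ = ⟨p + 1, Function.update m a x⟩) (hm : TameMem B s m) (ha : a < s)
    (hx : x ≤ B) : Reaches P w B s 1 ⟨p, m⟩ ⟨p + 1, Function.update m a x⟩ :=
  step hi he hm (hm.update ha hx)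

theorem jump_taken {p a l : ℕ} {m : ℕ → ℕ} (hi : P[p]? = some (.jumpZero a l))
    (hm : TameMem B s m) (h : m a = 0) : Reaches P w B s 1 ⟨p, m⟩ ⟨l, m⟩ :=
  step hi (by simp [RamInstr.exec, h]) hm hm

theorem jump_skipped {p a l : ℕ} {m : ℕ → ℕ} (hi : P[p]? = some (.jumpZero a l))
    (hm : TameMem B s m) (h : m a ≠ 0) : Reaches P w B s 1 ⟨p, m⟩ ⟨p + 1, m⟩ :=
  step hi (by simp [RamInstr.exec, h]) hm hm

end Reaches

/-- The instructions `code` stand in `P` from position `p` on. -/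
def CodeAt (P : RamProgram) (p : ℕ) (code : RamProgram) : Prop :=
  ∀ i < code.length, P[p + i]? = code[i]?

theorem codeAt_self (P : RamProgram) : CodeAt P 0 P := fun i _ => by simp

theorem codeAt_append {P : RamProgram} {p : ℕ} {code code' : RamProgram} :
    CodeAt P p (code ++ code') ↔ CodeAt P p code ∧ CodeAt P (p + code.length) code' := by
  constructor
  · refine fun h => ⟨fun i hi => ?_, fun i hi => ?_⟩
    · rw [h i (by simp; omega), List.getElem?_append_left hi]
    · rw [add_assoc, h (code.length + i) (by simp; omega), List.getElem?_append_right (by omega)]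
      simp
  · rintro ⟨h, h'⟩ i hi
    by_cases hc : i < code.length
    · rw [h i hc, List.getElem?_append_left hc]
    · rw [List.getElem?_append_right (by omega), ← h' (i - code.length) (by simp at hi; omega)]
      congr 1; omega

theorem codeAt_cons {P : RamProgram} {p : ℕ} {i : RamInstr} {code : RamProgram} :
    CodeAt P p (i :: code) ↔ P[p]? = some i ∧ CodeAt P (p + 1) code := by
  rw [show i :: code = [i] ++ code from rfl, codeAt_append]
  simp [CodeAt]

namespace CountExpr

variable {V : Type}

theorem comp_eq_of_eq_below {m m' : ℕ → ℕ} {ρ : V → ℕ} {b : ℕ} (hρ : ∀ v, ρ v < b)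
    (h : ∀ x < b, m' x = m x) : m' ∘ ρ = m ∘ ρ :=
  funext fun v => h _ (hρ v)

variable [DecidableEq V]

theorem comp_update {m : ℕ → ℕ} {ρ : V → ℕ} (v : V) (b : ℕ) :
    m ∘ Function.update ρ v b = Function.update (m ∘ ρ) v (m b) := by
  rw [Function.comp_update]

theorem update_lt {ρ : V → ℕ} {b : ℕ} (hρ : ∀ v, ρ v < b) (v : V) {x c : ℕ} (hb : b ≤ c)
    (hx : x < c) (u : V) : Function.update ρ v x u < c := by
  by_cases h : u = v
  · subst h; simpa
  · simpa [h] using (hρ u).trans_le hb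

/-- Stack discipline: everything below `b` survives, so variables and pending operands stay valid
while a subexpression runs higher up. The step count is exact because it depends only on `w 0`, so
runs compose by adding times. -/
theorem compile_correct {P : RamProgram} {w : ℕ → ℕ} {s c : ℕ} (e : CountExpr V)
    {ρ : V → ℕ} {b p a : ℕ} {m : ℕ → ℕ} (hρ : ∀ v, ρ v < b) (hP : CodeAt P p (e.compile ρ b p))
    (hm : TameMem ((w 0 + 2) ^ c) s m) (hs : b + e.cells ≤ s)
    (hw : ∀ i, w i ≤ (w 0 + 2) ^ a) (hφ : ∀ v, m (ρ v) ≤ (w 0 + 2) ^ a) (hc : e.growth a ≤ c) :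
    ∃ m', Reaches P w ((w 0 + 2) ^ c) s (e.time (w 0)) ⟨p, m⟩
        ⟨p + (e.compile ρ b p).length, m'⟩ ∧
      m' b = e.eval w (m ∘ ρ) ∧ ∀ x < b, m' x = m x := by
  have mono : ∀ {g h : ℕ}, g ≤ h → (w 0 + 2) ^ g ≤ (w 0 + 2) ^ h :=
    fun h => Nat.pow_le_pow_right (by omega) h
  have hval : e.eval w (m ∘ ρ) ≤ (w 0 + 2) ^ c := (e.eval_le hw hφ).trans (mono hc)
  have hone : 1 ≤ (w 0 + 2) ^ c := Nat.one_le_pow _ _ (by omega)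
  induction e generalizing ρ b p a m with
  | const x =>
    simp only [compile, codeAt_cons] at hP
    exact ⟨_, .write hP.1 rfl hm (by simp only [cells] at hs; omega) hval, by simp [eval],
      fun y hy => by simp [hy.ne]⟩
  | var v =>
    simp only [compile, codeAt_cons] at hP
    have hb : b < s := by simp only [cells] at hs; omega
    have r1 := Reaches.write (w := w) hP.1 rfl hm hb (Nat.zero_le _)
    refine ⟨_, r1.trans (.write (x := m (ρ v)) hP.2.1 ?_ r1.tame hb hval), by simp [eval],
      fun y hy => by simp [hy.ne]⟩
    simp [RamInstr.exec, (hρ v).ne]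
  | op o e f he hf =>
    simp only [compile, codeAt_append, codeAt_cons] at hP
    obtain ⟨hP1, hP2, hP3, -⟩ := hP
    simp only [cells] at hs
    simp only [growth] at hc
    obtain ⟨m1, r1, v1, k1⟩ := he hρ hP1 hm (by omega) hw hφ (by omega)
      ((e.eval_le hw hφ).trans (mono (by omega)))
    have hcomp := comp_eq_of_eq_below hρ k1
    have hφ1 : ∀ v, m1 (ρ v) ≤ (w 0 + 2) ^ a := fun v => by rw [k1 _ (hρ v)]; exact hφ v
    obtain ⟨m2, r2, v2, k2⟩ := hf (fun v => (hρ v).trans (by omega)) hP2 r1.tame (by omega) hw hφ1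
      (by omega) ((f.eval_le hw hφ1).trans (mono (by omega)))
    have r3 := Reaches.write (w := w) (x := (op o e f).eval w (m ∘ ρ)) (a := b) hP3 (by
      rw [o.exec_instr, v2, k2 b (by omega), v1, hcomp]; rfl) r2.tame (by omega) hval
    refine ⟨Function.update m2 b _, ?_, Function.update_self .., fun y hy => ?_⟩
    · convert r1.trans (r2.trans r3) using 2
      · rfl
      · simp [compile]; omega
    · rw [Function.update_of_ne hy.ne, k2 y (by omega), k1 y hy]
  | read e he =>
    simp only [compile, codeAt_append, codeAt_cons] at hP
    obtain ⟨hP1, hP2, -⟩ := hP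
    simp only [cells] at hs
    obtain ⟨m1, r1, v1, k1⟩ := he hρ hP1 hm (by omega) hw hφ hc
      ((e.eval_le hw hφ).trans (mono hc))
    have r2 := Reaches.write (w := w) (x := (read e).eval w (m ∘ ρ)) (a := b) hP2 (by
      simp [RamInstr.exec, v1, eval]) r1.tame (by omega) hval
    refine ⟨Function.update m1 b _, ?_, Function.update_self .., fun y hy => ?_⟩
    · convert r1.trans r2 using 2
      · rfl
      · simp [compile]; omega
    · rw [Function.update_of_ne hy.ne, k1 y hy]
  | bind v e f he hf =>
    simp only [compile, codeAt_append, codeAt_cons] at hP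
    obtain ⟨hP1, hP2, hP3, hP4, -⟩ := hP
    simp only [cells] at hs
    simp only [growth] at hc
    have hec := (f.le_growth (e.growth a)).trans hc
    obtain ⟨m1, r1, v1, k1⟩ := he hρ hP1 hm (by omega) hw hφ hec
      ((e.eval_le hw hφ).trans (mono hec))
    have hcomp : m1 ∘ Function.update ρ v b = Function.update (m ∘ ρ) v (e.eval w (m ∘ ρ)) := by
      rw [comp_update, comp_eq_of_eq_below hρ k1, v1]
    have hφ1 : ∀ u, m1 (Function.update ρ v b u) ≤ (w 0 + 2) ^ e.growth a := fun u => by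
      have := update_le (φ := m ∘ ρ) (fun u => (hφ u).trans (mono (e.le_growth a))) v
        (e.eval_le (φ := m ∘ ρ) hw hφ) u
      rwa [← hcomp] at this
    obtain ⟨m2, r2, v2, k2⟩ := hf (update_lt hρ v (by omega) (by omega)) hP2 r1.tame (by omega)
      (fun i => (hw i).trans (mono (e.le_growth a))) hφ1 hc (by rw [hcomp]; exact hval)
    have r3 := Reaches.write (w := w) hP3 rfl r2.tame (by omega) (Nat.zero_le _)
    have r4 := Reaches.write (w := w) (x := (bind v e f).eval w (m ∘ ρ)) (a := b) hP4 (by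
      simp [RamInstr.exec, v2, hcomp, eval]) r3.tame (by omega) hval
    refine ⟨Function.update (Function.update m2 b 0) b _, ?_, Function.update_self .., fun y hy => ?_⟩
    · convert r1.trans (r2.trans (r3.trans r4)) using 2
      · rfl
      · simp [compile]; omega
    · rw [Function.update_of_ne hy.ne, Function.update_of_ne hy.ne, k2 y (by omega), k1 y hy]
  | sum v e he =>
    simp only [compile, codeAt_append, codeAt_cons] at hP
    obtain ⟨hP0, hP1, hP2, hP3, hP4, hP5, hP6, hP7, hP8, -⟩ := hP
    simp only [cells] at hs
    simp only [growth] at hc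
    set l := (e.compile (Function.update ρ v (b + 1)) (b + 2) (p + 5)).length with hl
    set F : ℕ → ℕ := fun x => e.eval w (Function.update (m ∘ ρ) v x) with hF
    have hn : w 0 ≤ (w 0 + 2) ^ c := (hw 0).trans (mono ((e.le_growth a).trans (by omega)))
    -- The counter runs downwards: when it is `i`, the terms with index from `i` on have been added.
    -- The next round decrements first, so its summand is the one for the decremented counter.
    have loop : ∀ i ≤ w 0, ∀ m1, TameMem ((w 0 + 2) ^ c) s m1 → m1 (b + 1) = i →
        m1 b = ∑ x ∈ Finset.Ico i (w 0), F x → (∀ x < b, m1 x = m x) →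
        ∃ m', Reaches P w ((w 0 + 2) ^ c) s (i * (e.time (w 0) + 6) + 1) ⟨p + 2, m1⟩
          ⟨p + 5 + l + 3, m'⟩ ∧ m' b = ∑ x ∈ Finset.range (w 0), F x ∧ ∀ x < b, m' x = m x := by
      intro i
      induction i with
      | zero =>
        intro _ m1 hm1 h1 h2 h3
        refine ⟨m1, ?_, by rw [h2, Finset.range_eq_Ico], h3⟩
        rw [zero_mul]
        exact .jump_taken hP2 hm1 h1
      | succ i ih =>
        intro hi m1 hm1 h1 h2 h3
        have r1 := Reaches.jump_skipped (w := w) hP2 hm1 (by omega)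
        have r2 := Reaches.write (w := w) hP3 rfl hm1 (by omega) hone
        have r3 := Reaches.write (w := w) (x := i) (a := b + 1) hP4 (by
          simp [RamInstr.exec, h1]) r2.tame (by omega) (by omega)
        set m3 := Function.update (Function.update m1 (b + 2) 1) (b + 1) i with hm3
        have k3 : ∀ x < b + 1, m3 x = m1 x := fun x hx => by
          rw [hm3, Function.update_of_ne (by omega), Function.update_of_ne (by omega)]
        have hcomp : m3 ∘ Function.update ρ v (b + 1) = Function.update (m ∘ ρ) v i := by
          rw [comp_update, comp_eq_of_eq_below hρ fun x hx => (k3 x (by omega)).trans (h3 x hx)]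
          simp [hm3]
        have hφ3 : ∀ u, m3 (Function.update ρ v (b + 1) u) ≤ (w 0 + 2) ^ a := fun u => by
          have := update_le (φ := m ∘ ρ) hφ v (x := i) ((show i ≤ w 0 by omega).trans (hw 0)) u
          rwa [← hcomp] at this
        obtain ⟨m4, r4, v4, k4⟩ := he (update_lt hρ v (by omega) (by omega)) hP5 r3.tame
          (by omega) hw hφ3 (by omega) ((e.eval_le hw hφ3).trans (mono (by omega)))
        rw [hcomp] at v4
        have hb4 : m4 b = ∑ x ∈ Finset.Ico (i + 1) (w 0), F x := by
          rw [k4 b (by omega), k3 b (by omega), h2]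
        have hi4 : m4 (b + 1) = i := by rw [k4 _ (by omega)]; simp [hm3]
        have hsum : ∑ x ∈ Finset.Ico (i + 1) (w 0), F x + F i = ∑ x ∈ Finset.Ico i (w 0), F x := by
          rw [Finset.sum_eq_sum_Ico_succ_bot (show i < w 0 by omega), add_comm]
        have r5 := Reaches.write (w := w) (x := ∑ x ∈ Finset.Ico i (w 0), F x) (a := b) hP6 (by
          simp only [RamInstr.exec, hb4, v4, ← hsum]; rfl) r4.tame (by omega) (by
          refine le_trans ?_ hval
          simp only [eval, Finset.range_eq_Ico]
          exact Finset.sum_le_sum_of_subset (Finset.Ico_subset_Ico_left (Nat.zero_le _)))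
        -- Clearing the tested cell makes the following conditional jump unconditional.
        have r6 := Reaches.write (w := w) hP7 rfl r5.tame (by omega) (Nat.zero_le _)
        have r7 := Reaches.jump_taken (w := w) hP8 r6.tame (by simp)
        obtain ⟨m', r8, v8, k8⟩ := ih (by omega) _ r7.tame (by simp [hi4]) (by simp)
          (fun x hx => by
            rw [Function.update_of_ne (by omega), Function.update_of_ne (by omega),
              k4 x (by omega), k3 x (by omega), h3 x hx])
        refine ⟨m', ?_, v8, k8⟩
        convert r1.trans (r2.trans (r3.trans (r4.trans (r5.trans (r6.trans (r7.trans r8))))))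
          using 1
        ring
    have r1 := Reaches.write (w := w) hP0 rfl hm (by omega) (Nat.zero_le _)
    have r2 := Reaches.write (w := w) (x := w 0) (a := b + 1) hP1 (by
      simp [RamInstr.exec]) r1.tame (by omega) hn
    obtain ⟨m', r3, v3, k3⟩ := loop (w 0) le_rfl _ r2.tame (by simp) (by simp) (fun x hx => by
      rw [Function.update_of_ne (by omega), Function.update_of_ne (by omega)])
    refine ⟨m', ?_, v3, k3⟩
    convert r1.trans (r2.trans r3) using 1
    · simp only [time]; ring
    · simp [compile, ← hl]; omega

/-- The program that evaluates an expression in which every variable has the value zero. -/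
def program (e : CountExpr V) : RamProgram :=
  -- All variables share cell `0`, which stays zero until the last instruction; subtracting it from
  -- cell `1` therefore copies the result.
  e.compile (fun _ => 0) 1 0 ++ [.sub 0 1 0]

theorem program_computes {w : ℕ → ℕ} {a : ℕ} (e : CountExpr V)
    (hw : ∀ i, w i ≤ (w 0 + 2) ^ a) {T : ℕ} (hT : e.time (w 0) + 1 ≤ T) :
    RamComputes e.program w T (1 + e.cells) ((w 0 + 2) ^ e.growth a) (e.eval w fun _ => 0) := by
  have hP := codeAt_self e.program
  rw [show CodeAt e.program 0 e.program =
    CodeAt e.program 0 (e.compile (fun _ => 0) 1 0 ++ [.sub 0 1 0]) from rfl] at hP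
  simp only [codeAt_append, codeAt_cons] at hP
  obtain ⟨hP1, hP2, -⟩ := hP
  obtain ⟨m', r1, v1, k1⟩ := e.compile_correct (m := fun _ => 0) (fun _ => Nat.one_pos) hP1
    (fun _ => ⟨Nat.zero_le _, fun _ => rfl⟩) le_rfl hw (fun _ => Nat.zero_le _) le_rfl
  have r2 := Reaches.write (w := w) (x := e.eval w fun _ => 0) (a := 0) hP2 (by
    simp only [RamInstr.exec, v1, k1 0 Nat.one_pos]; rfl) r1.tame (by omega)
    (e.eval_le hw fun _ => Nat.zero_le _)
  have r := r1.trans r2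
  have hlen : e.program.length ≤ 0 + (e.compile (fun _ => 0) 1 0).length + 1 := by simp [program]
  have hfix : ∀ j, ramRun e.program w (j + (e.time (w 0) + 1)) =
      ⟨0 + (e.compile (fun _ => 0) 1 0).length + 1, Function.update m' 0 (e.eval w fun _ => 0)⟩ := by
    intro j
    rw [ramRun, Function.iterate_add_apply, r.1]
    apply Function.iterate_fixed
    simp only [ramStep, List.getElem?_eq_none hlen]
  obtain ⟨j, rfl⟩ : ∃ j, T = j + (e.time (w 0) + 1) := ⟨T - (e.time (w 0) + 1), by omega⟩
  refine ⟨by rw [hfix]; exact hlen, by rw [hfix]; simp, fun i => ?_⟩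
  by_cases hi : i ≤ e.time (w 0) + 1
  · exact r.2 i hi
  · obtain ⟨k, rfl⟩ : ∃ k, i = k + (e.time (w 0) + 1) := ⟨i - (e.time (w 0) + 1), by omega⟩
    rw [hfix]
    exact r.tame

end CountExpr

/-! ### Expressions over out-neighbour lists -/

namespace CountExpr

variable {V ι : Type}

/-- The sum of a finite family of expressions. -/
noncomputable def sumOver (s : Finset ι) (f : ι → CountExpr V) : CountExpr V :=
  (s.toList.map f).foldr (op .add) (const 0)

/-- The product of a finite family of expressions. -/
noncomputable def prodOver (s : Finset ι) (f : ι → CountExpr V) : CountExpr V :=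
  (s.toList.map f).foldr (op .mul) (const 1)

theorem depth_foldr_le {m : ℕ} (o : ArithOp) (c : ℕ) (l : List (CountExpr V))
    (h : ∀ e ∈ l, e.depth ≤ m) : (l.foldr (op o) (const c)).depth ≤ m := by
  induction l with
  | nil => simp [depth]
  | cons e l ih => simp_all [depth]

theorem depth_sumOver_le {m : ℕ} {s : Finset ι} {f : ι → CountExpr V}
    (h : ∀ i ∈ s, (f i).depth ≤ m) : (sumOver s f).depth ≤ m :=
  depth_foldr_le _ _ _ (by simpa using h)

theorem depth_prodOver_le {m : ℕ} {s : Finset ι} {f : ι → CountExpr V}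
    (h : ∀ i ∈ s, (f i).depth ≤ m) : (prodOver s f).depth ≤ m :=
  depth_foldr_le _ _ _ (by simpa using h)

/-- The number `1` if two expressions have the same value, and `0` otherwise. -/
def eqTest (e f : CountExpr V) : CountExpr V :=
  -- With truncated subtraction the two differences add up to the absolute difference.
  op .sub (const 1) (op .add (op .sub e f) (op .sub f e))

/-- The number `1` if the value of `u` has an out-neighbour with index `j`, and `0` otherwise. -/
def hasOut (d : ℕ) (u : V) (j : ℕ) : CountExpr V :=
  op .sub (const 1) (op .sub (const (j + 1))
    (read (op .add (op .mul (var u) (const (d + 1))) (const 1))))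

/-- The out-neighbour with index `j` of the value of `u`. -/
def outNeighbor (d : ℕ) (u : V) (j : ℕ) : CountExpr V :=
  read (op .add (op .mul (var u) (const (d + 1))) (const (j + 2)))

/-- The sum of `f y` over the out-neighbours `y` of the value of `u`. -/
noncomputable def outSum (d : ℕ) (u : V) (f : CountExpr V → CountExpr V) : CountExpr V :=
  -- The `d` slots are written out as separate terms, so no machine loop and no depth is spent. The
  -- factor `hasOut` cancels the padding zeros, which would otherwise be read as vertex `0`.
  sumOver (Finset.range d) fun j => op .mul (hasOut d u j) (f (outNeighbor d u j))

/-- The number `1` if there is an arc from the value of `u` to that of `v`, and `0` otherwise. -/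
noncomputable def arcTest (d : ℕ) (u v : V) : CountExpr V :=
  outSum d u fun e => eqTest e (var v)

theorem depth_outSum_le {m d : ℕ} {u : V} {f : CountExpr V → CountExpr V}
    (h : ∀ e, e.depth = 0 → (f e).depth ≤ m) : (outSum d u f).depth ≤ m :=
  depth_sumOver_le fun j _ => by
    simpa [depth, hasOut] using h (outNeighbor d u j) (by simp [outNeighbor, depth])

theorem depth_arcTest (d : ℕ) (u v : V) : (arcTest d u v).depth = 0 :=
  Nat.le_zero.mp (depth_outSum_le fun e he => by simp [eqTest, depth, he])

variable [DecidableEq V]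

theorem eval_sumOver (w : ℕ → ℕ) (s : Finset ι) (f : ι → CountExpr V) (φ : V → ℕ) :
    (sumOver s f).eval w φ = ∑ i ∈ s, (f i).eval w φ := by
  rw [← Finset.sum_map_toList, sumOver]
  induction s.toList with
  | nil => rfl
  | cons i l ih => simp [eval, ih, ArithOp.apply]

theorem eval_prodOver (w : ℕ → ℕ) (s : Finset ι) (f : ι → CountExpr V) (φ : V → ℕ) :
    (prodOver s f).eval w φ = ∏ i ∈ s, (f i).eval w φ := by
  rw [← Finset.prod_map_toList, prodOver]
  induction s.toList with
  | nil => rfl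
  | cons i l ih => simp [eval, ih, ArithOp.apply]

theorem eval_eqTest (w : ℕ → ℕ) (e f : CountExpr V) (φ : V → ℕ) :
    (eqTest e f).eval w φ = if e.eval w φ = f.eval w φ then 1 else 0 := by
  simp only [eqTest, eval, ArithOp.apply]
  split_ifs <;> omega

end CountExpr

/-- The array `w` encodes the out-neighbour lists `L` of a digraph on the numbers below `w 0` with
all outdegrees at most `d`. -/
structure EncodesLists (w : ℕ → ℕ) (d : ℕ) (L : ℕ → List ℕ) : Prop where
  nodup : ∀ x, (L x).Nodup
  length_le : ∀ x, (L x).length ≤ d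
  lt : ∀ x, ∀ y ∈ L x, y < w 0
  word_length : ∀ x, w (x * (d + 1) + 1) = (L x).length
  word_get : ∀ x j, (h : j < (L x).length) → w (x * (d + 1) + (j + 2)) = (L x)[j]

theorem List.sum_range_dite_getElem (l : List ℕ) {d : ℕ} (hd : l.length ≤ d) (F : ℕ → ℕ) :
    (∑ j ∈ Finset.range d, if h : j < l.length then F l[j] else 0) = (l.map F).sum := by
  induction l generalizing d with
  | nil => simp
  | cons x l ih =>
    obtain ⟨d, rfl⟩ : ∃ r, d = r + 1 := ⟨d - 1, by simp at hd; omega⟩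
    rw [Finset.sum_range_succ', List.map_cons, List.sum_cons, ← ih (d := d) (by simpa using hd),
      add_comm]
    simp

namespace CountExpr

variable {V : Type} [DecidableEq V] {w : ℕ → ℕ} {d : ℕ} {L : ℕ → List ℕ}

theorem eval_outSum (hL : EncodesLists w d L) {u : V} {f : CountExpr V → CountExpr V}
    {φ : V → ℕ} {F : ℕ → ℕ} (hF : ∀ e, (f e).eval w φ = F (e.eval w φ)) :
    (outSum d u f).eval w φ = ∑ y ∈ (L (φ u)).toFinset, F y := by
  rw [List.sum_toFinset F (hL.nodup _),
    ← List.sum_range_dite_getElem (L (φ u)) (hL.length_le _) F, outSum, eval_sumOver]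
  refine Finset.sum_congr rfl fun j _ => ?_
  simp only [eval, hasOut, ArithOp.apply, hF, outNeighbor, hL.word_length]
  split_ifs with h
  · rw [hL.word_get _ _ h, show 1 - (j + 1 - (L (φ u)).length) = 1 by omega, one_mul]
  · rw [show 1 - (j + 1 - (L (φ u)).length) = 0 by omega, zero_mul]

theorem eval_arcTest (hL : EncodesLists w d L) (u v : V) (φ : V → ℕ) :
    (arcTest d u v).eval w φ = if φ v ∈ L (φ u) then 1 else 0 := by
  rw [arcTest, eval_outSum hL (F := fun y => if y = φ v then 1 else 0)
    fun e => by rw [eval_eqTest]; rfl]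
  simp

end CountExpr

/-! ### Counting extensions of partial maps -/

section ArcsKept

variable {V : Type}

/-- The map `ψ` sends every arc of `E` with tail in `S` to an arc of the digraph with
out-neighbour lists `L`. -/
def ArcsKept (E : V → V → Prop) (L : ℕ → List ℕ) (S : Set V) (ψ : V → ℕ) : Prop :=
  ∀ u ∈ S, ∀ v, E u v → ψ v ∈ L (ψ u)

theorem arcsKept_congr {E : V → V → Prop} {L : ℕ → List ℕ} {S : Set V} {ψ χ : V → ℕ}
    (h : ∀ u ∈ S, ψ u = χ u) (h' : ∀ u ∈ S, ∀ v, E u v → ψ v = χ v) :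
    ArcsKept E L S ψ ↔ ArcsKept E L S χ := by
  refine forall₂_congr fun u hu => forall₂_congr fun v hv => ?_
  rw [h u hu, h' u hu v hv]

theorem arcsKept_union {E : V → V → Prop} {L : ℕ → List ℕ} {S T : Set V} {ψ : V → ℕ} :
    ArcsKept E L (S ∪ T) ψ ↔ ArcsKept E L S ψ ∧ ArcsKept E L T ψ := by
  simp only [ArcsKept, Set.mem_union, or_imp, forall_and]

open Classical in
/-- The indicator of `ArcsKept`. -/
noncomputable def keptInd (E : V → V → Prop) (L : ℕ → List ℕ) (S : Set V) (ψ : V → ℕ) : ℕ :=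
  if ArcsKept E L S ψ then 1 else 0

theorem keptInd_union (E : V → V → Prop) (L : ℕ → List ℕ) (S T : Set V) (ψ : V → ℕ) :
    keptInd E L (S ∪ T) ψ = keptInd E L S ψ * keptInd E L T ψ := by
  by_cases h : ArcsKept E L S ψ <;> by_cases h' : ArcsKept E L T ψ <;>
    simp [keptInd, arcsKept_union, h, h']

theorem keptInd_congr {E : V → V → Prop} {L : ℕ → List ℕ} {S : Set V} {ψ χ : V → ℕ}
    (h : ∀ u ∈ S, ψ u = χ u) (h' : ∀ u ∈ S, ∀ v, E u v → ψ v = χ v) :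
    keptInd E L S ψ = keptInd E L S χ := by
  by_cases hk : ArcsKept E L S ψ
  · rw [keptInd, keptInd, if_pos hk, if_pos ((arcsKept_congr h h').mp hk)]
  · rw [keptInd, keptInd, if_neg hk, if_neg (mt (arcsKept_congr h h').mpr hk)]

end ArcsKept

section Extensions

variable {V : Type} [Fintype V] [DecidableEq V]

open Classical in
/-- The maps that agree with `φ` outside `S` and have values below `n` on `S`. -/
noncomputable def assignments (n : ℕ) (S : Set V) (φ : V → ℕ) : Finset (V → ℕ) :=
  Fintype.piFinset fun v => if v ∈ S then Finset.range n else {φ v}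

theorem mem_assignments {n : ℕ} {S : Set V} {φ ψ : V → ℕ} :
    ψ ∈ assignments n S φ ↔ (∀ v ∈ S, ψ v < n) ∧ ∀ v ∉ S, ψ v = φ v := by
  simp only [assignments, Fintype.mem_piFinset]
  refine ⟨fun h => ⟨fun v hv => by simpa [hv] using h v, fun v hv => by simpa [hv] using h v⟩,
    fun h v => ?_⟩
  by_cases hv : v ∈ S
  · simpa [hv] using h.1 v hv
  · simpa [hv] using h.2 v hv

theorem assignments_empty (n : ℕ) (φ : V → ℕ) : assignments n ∅ φ = {φ} := by
  ext ψ
  simp [mem_assignments, funext_iff]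

/-- The intermediate map is determined by the final one: it agrees with `χ` on `S` and with `φ`
elsewhere. -/
theorem sum_assignments_union {n : ℕ} {S T : Set V} (hST : Disjoint S T) (φ : V → ℕ)
    (F : (V → ℕ) → ℕ) :
    ∑ ψ ∈ assignments n (S ∪ T) φ, F ψ =
      ∑ ψ ∈ assignments n S φ, ∑ χ ∈ assignments n T ψ, F χ := by
  have hST' : ∀ v ∈ S, v ∉ T := fun v hS hT => Set.disjoint_left.mp hST hS hT
  rw [← Finset.sum_biUnion]
  · congr 1
    ext χ
    simp only [Finset.mem_biUnion, mem_assignments]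
    constructor
    · rintro ⟨h1, h2⟩
      classical
      refine ⟨fun v => if v ∈ S then χ v else φ v, ⟨fun v hv => ?_, fun v hv => ?_⟩,
        fun v hv => h1 v (Or.inr hv), fun v hv => ?_⟩
      · simpa [hv] using h1 v (Or.inl hv)
      · simp [hv]
      · by_cases hS : v ∈ S
        · simp [hS]
        · simpa [hS] using h2 v (by simp [hS, hv])
    · rintro ⟨ψ, ⟨h1, h2⟩, h3, h4⟩
      refine ⟨fun v hv => ?_, fun v hv => ?_⟩
      · rcases hv with hv | hv
        · rw [h4 v (hST' v hv)]; exact h1 v hv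
        · exact h3 v hv
      · simp only [Set.mem_union, not_or] at hv
        rw [h4 v hv.2, h2 v hv.1]
  · intro ψ hψ ψ' hψ' hne
    rw [Function.onFun, Finset.disjoint_left]
    intro χ hχ hχ'
    rw [Finset.mem_coe, mem_assignments] at hψ hψ'
    rw [mem_assignments] at hχ hχ'
    refine hne (funext fun v => ?_)
    by_cases hS : v ∈ S
    · rw [← hχ.2 v (hST' v hS), hχ'.2 v (hST' v hS)]
    · rw [hψ.2 v hS, hψ'.2 v hS]

theorem sum_assignments_singleton (n : ℕ) (v : V) (φ : V → ℕ) (F : (V → ℕ) → ℕ) :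
    ∑ ψ ∈ assignments n {v} φ, F ψ = ∑ x ∈ Finset.range n, F (Function.update φ v x) := by
  refine Finset.sum_nbij' (fun ψ => ψ v) (fun x => Function.update φ v x) ?_ ?_ ?_ ?_ ?_
  · intro ψ hψ
    exact Finset.mem_range.mpr ((mem_assignments.mp hψ).1 v rfl)
  · intro x hx
    rw [mem_assignments]
    exact ⟨fun u hu => by obtain rfl : u = v := hu
                          simpa using hx,
      fun u hu => Function.update_of_ne hu _ _⟩
  · intro ψ hψ
    funext u
    by_cases hu : u = v
    · subst hu; simp
    · simpa [hu] using ((mem_assignments.mp hψ).2 u hu).symm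
  · simp
  · intro ψ hψ
    congr 1
    funext u
    by_cases hu : u = v
    · subst hu; simp
    · simpa [hu] using ((mem_assignments.mp hψ).2 u hu)

/-- The number of maps that extend the restriction of `φ` to the complement of `S` and keep all
arcs with tail in `S`. -/
noncomputable def extCount (E : V → V → Prop) (L : ℕ → List ℕ) (n : ℕ) (S : Set V)
    (φ : V → ℕ) : ℕ :=
  ∑ ψ ∈ assignments n S φ, keptInd E L S ψ

variable {E : V → V → Prop} {L : ℕ → List ℕ} {n : ℕ}

theorem extCount_empty (φ : V → ℕ) : extCount E L n ∅ φ = 1 := by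
  simp [extCount, assignments_empty, keptInd, ArcsKept]

/-- Arcs with tail in `S` have their heads outside `T`, so their indicator does not change while `T`
is being assigned and factors out of the inner sum. -/
theorem extCount_union {S T : Set V} (hST : Disjoint S T) (harc : ∀ u ∈ S, ∀ v ∈ T, ¬ E u v)
    (φ : V → ℕ) :
    extCount E L n (S ∪ T) φ =
      ∑ ψ ∈ assignments n S φ, keptInd E L S ψ * extCount E L n T ψ := by
  rw [extCount, sum_assignments_union hST]
  refine Finset.sum_congr rfl fun ψ _ => ?_
  rw [extCount, Finset.mul_sum]
  refine Finset.sum_congr rfl fun χ hχ => ?_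
  have h := (mem_assignments.mp hχ).2
  rw [keptInd_union, keptInd_congr (fun u hu => h u (Set.disjoint_left.mp hST hu))
    fun u hu v huv => h v fun hv => harc u hu v hv huv]

/-- Outside `T` only the heads of arcs leaving `T` are inspected; exchanging the values outside `T`
is a bijection between the two families of extensions. -/
theorem extCount_congr {T : Set V} {φ φ' : V → ℕ} (h : ∀ u ∈ T, ∀ v ∉ T, E u v → φ v = φ' v) :
    extCount E L n T φ = extCount E L n T φ' := by
  classical
  have key : ∀ φ φ' ψ : V → ℕ, ψ ∈ assignments n T φ →
      (fun v => if v ∈ T then ψ v else φ' v) ∈ assignments n T φ' := by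
    intro φ φ' ψ hψ
    rw [mem_assignments] at hψ ⊢
    exact ⟨fun v hv => by simpa [hv] using hψ.1 v hv, fun v hv => by simp [hv]⟩
  have inv : ∀ φ φ' ψ : V → ℕ, ψ ∈ assignments n T φ →
      (fun v => if v ∈ T then (if v ∈ T then ψ v else φ' v) else φ v) = ψ := by
    intro φ φ' ψ hψ
    funext v
    by_cases hv : v ∈ T
    · simp [hv]
    · simp [hv, (mem_assignments.mp hψ).2 v hv]
  refine Finset.sum_nbij' (fun ψ v => if v ∈ T then ψ v else φ' v)
    (fun ψ v => if v ∈ T then ψ v else φ v) (key φ φ') (key φ' φ) (inv φ φ') (inv φ' φ) ?_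
  intro ψ hψ
  refine keptInd_congr (fun u hu => by simp [hu]) fun u hu v huv => ?_
  by_cases hv : v ∈ T
  · simp [hv]
  · simp [hv, (mem_assignments.mp hψ).2 v hv, h u hu v hv huv]

theorem extCount_union_of_no_arcs {S T : Set V} (hST : Disjoint S T)
    (harc : ∀ u ∈ S, ∀ v ∈ T, ¬ E u v ∧ ¬ E v u) (φ : V → ℕ) :
    extCount E L n (S ∪ T) φ = extCount E L n S φ * extCount E L n T φ := by
  rw [extCount_union hST fun u hu v hv => (harc u hu v hv).1, extCount.eq_1 E L n S,
    Finset.sum_mul]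
  refine Finset.sum_congr rfl fun ψ hψ => ?_
  congr 1
  exact extCount_congr fun u hu v _ huv => (mem_assignments.mp hψ).2 v fun hv =>
    (harc v hv u hu).2 huv

theorem extCount_biUnion {ι : Type*} (A : ι → Set V)
    (hdisj : ∀ i j, i ≠ j → Disjoint (A i) (A j))
    (harc : ∀ i j, i ≠ j → ∀ u ∈ A i, ∀ v ∈ A j, ¬ E u v) (s : Finset ι) (φ : V → ℕ) :
    extCount E L n (⋃ i ∈ s, A i) φ = ∏ i ∈ s, extCount E L n (A i) φ := by
  classical
  induction s using Finset.induction_on with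
  | empty => simp [extCount_empty]
  | insert i s hi ih =>
    rw [Finset.set_biUnion_insert, Finset.prod_insert hi, extCount_union_of_no_arcs, ih]
    · simp only [Set.disjoint_iUnion_right]
      exact fun j hj => hdisj i j (by rintro rfl; exact hi hj)
    · simp only [Set.mem_iUnion]
      rintro u hu v ⟨j, hj, hv⟩
      have hij : i ≠ j := by rintro rfl; exact hi hj
      exact ⟨harc i j hij u hu v hv, harc j i hij.symm v hv u hu⟩

end Extensions

/-! ### Reachability and components -/

section Reach

variable {V : Type} {E : V → V → Prop}

theorem reachIn_subset {S : Set V} {s : V} (hs : s ∈ S) : reachIn E S s ⊆ S := by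
  intro v hv
  rcases Relation.ReflTransGen.cases_tail hv with rfl | ⟨u, -, h⟩
  · exact hs
  · exact h.2.1

theorem not_arc_of_mem_reachIn {S : Set V} {s u v : V} (hs : s ∈ S) (hu : u ∈ reachIn E S s)
    (hv : v ∈ S \ reachIn E S s) : ¬ E u v :=
  fun h => hv.2 (Relation.ReflTransGen.tail hu ⟨reachIn_subset hs hu, hv.1, h⟩)

/-- A proper subset of the reachable vertices that contains the root can be left along an arc. -/
theorem exists_arc_leaving {S A : Set V} {s : V} (hs : s ∈ A) {x : V}
    (hx : x ∈ reachIn E S s) (hxA : x ∉ A) :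
    ∃ u ∈ A, ∃ v ∈ reachIn E S s, v ∉ A ∧ E u v := by
  by_contra! h
  have hall : ∀ y, y ∈ reachIn E S s → y ∈ A := by
    intro y hy
    induction hy with
    | refl => exact hs
    | tail hab hbc ih =>
      by_contra hc
      exact h _ ih _ (Relation.ReflTransGen.tail hab hbc) hc hbc.2.2
  exact hxA (hall x hx)

theorem IsAcyclicRel.wellFounded [Finite V] (hE : IsAcyclicRel E) : WellFounded E := by
  have : Std.Irrefl (Relation.TransGen E) := ⟨hE⟩
  have : IsTrans V (Relation.TransGen E) := ⟨fun _ _ _ => Relation.TransGen.trans⟩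
  exact Subrelation.wf Relation.TransGen.single
    (Finite.wellFounded_of_trans_of_irrefl (Relation.TransGen E))

/-- If there is only one source, then every vertex is reachable from it. -/
theorem reachIn_eq_of_unique_source [Finite V] (hE : IsAcyclicRel E) {S : Set V} {s : V}
    (hs : IsSourceIn E S s) (huniq : ∀ s', IsSourceIn E S s' → s' = s) : reachIn E S s = S := by
  refine (reachIn_subset hs.1).antisymm fun v => ?_
  -- A vertex that is not a source has an in-neighbour in `S`, which is reachable by induction.
  induction v using hE.wellFounded.induction with
  | _ v ih =>
    intro hv
    by_cases hsrc : IsSourceIn E S v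
    · rw [huniq v hsrc]; exact Relation.ReflTransGen.refl
    · obtain ⟨u, hu, huv⟩ : ∃ u ∈ S, E u v := by
        by_contra! h
        exact hsrc ⟨hv, h⟩
      exact Relation.ReflTransGen.tail (ih u huv hu) ⟨hu, hv, huv⟩

theorem iUnion_componentIn (E : V → V → Prop) (S : Set V) : ⋃ c, componentIn E S c = S := by
  ext v
  simp only [Set.mem_iUnion, componentIn, Set.mem_image]
  constructor
  · rintro ⟨c, x, -, rfl⟩; exact x.2
  · exact fun hv => ⟨(underlyingIn E S).connectedComponentMk ⟨v, hv⟩, ⟨v, hv⟩, rfl, rfl⟩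

theorem componentIn_disjoint {S : Set V} {c c' : (underlyingIn E S).ConnectedComponent}
    (h : c ≠ c') : Disjoint (componentIn E S c) (componentIn E S c') := by
  rw [Set.disjoint_left]
  rintro _ ⟨x, hx, rfl⟩ ⟨y, hy, hxy⟩
  obtain rfl : y = x := Subtype.ext hxy
  exact h (hx.symm.trans hy)

theorem componentIn_no_arc {S : Set V} {c c' : (underlyingIn E S).ConnectedComponent}
    (h : c ≠ c') : ∀ u ∈ componentIn E S c, ∀ v ∈ componentIn E S c', ¬ E u v := by
  rintro _ ⟨x, hx, rfl⟩ _ ⟨y, hy, rfl⟩ hxy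
  have hne : (x : V) ≠ y := by
    intro he
    obtain rfl := Subtype.ext he
    exact h (hx.symm.trans hy)
  have hadj : (underlyingIn E S).Adj x y :=
    SimpleGraph.comap_adj.mpr ((SimpleGraph.fromRel_adj E _ _).mpr ⟨hne, Or.inl hxy⟩)
  exact h (hx.symm.trans ((SimpleGraph.ConnectedComponent.sound hadj.reachable).trans hy))

end Reach

/-! ### From elimination forests to expressions -/

section ElimForest

variable {V : Type} [Fintype V] [DecidableEq V] {E : V → V → Prop}

/-- The expression `e` counts the extensions of the assignment of its variables to `S`. -/
def CountsExtensions (E : V → V → Prop) (d : ℕ) (S : Set V) (e : CountExpr V) : Prop :=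
  ∀ w L, EncodesLists w d L → ∀ φ, e.eval w φ = extCount E L (w 0) S φ

open Classical in
theorem exists_expr_keptInd (E : V → V → Prop) (d : ℕ) (R : Set V) :
    ∃ e : CountExpr V, e.depth = 0 ∧
      ∀ w L, EncodesLists w d L → ∀ φ, e.eval w φ = keptInd E L R φ := by
  refine ⟨.prodOver (Finset.univ.filter fun a : V × V => a.1 ∈ R ∧ E a.1 a.2)
    fun a => .arcTest d a.1 a.2,
    Nat.le_zero.mp (CountExpr.depth_prodOver_le fun a _ => (CountExpr.depth_arcTest ..).le),
    fun w L hL φ => ?_⟩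
  simp only [CountExpr.eval_prodOver, CountExpr.eval_arcTest hL, Finset.prod_boole, keptInd]
  congr 1
  simpa [ArcsKept] using forall_congr' fun u => forall_comm

/-- Here `A` is the part of the reach of `s` that already has images. While it is proper, some arc
`u → v` leaves it, and the image of `v` must be one of the at most `d` out-neighbours of the image
of `u`. This extends `A` by `v` without increasing the depth. -/
theorem exists_expr_of_partial_reach {d m : ℕ} {S : Set V} {s : V} {e : CountExpr V}
    (he : CountsExtensions E d (S \ reachIn E S s) e) (hm : e.depth ≤ m) (N : ℕ) :
    ∀ A : Set V, s ∈ A → A ⊆ reachIn E S s → (reachIn E S s \ A).ncard = N →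
      ∃ f : CountExpr V, f.depth ≤ m ∧ ∀ w L, EncodesLists w d L → ∀ φ, f.eval w φ =
        ∑ ψ ∈ assignments (w 0) (reachIn E S s \ A) φ,
          keptInd E L (reachIn E S s) ψ * extCount E L (w 0) (S \ reachIn E S s) ψ := by
  set R := reachIn E S s with hR
  induction N with
  | zero =>
    intro A hs hA hcard
    rw [Set.ncard_eq_zero] at hcard
    obtain ⟨f, hf, hf'⟩ := exists_expr_keptInd E d R
    refine ⟨.op .mul f e, by simp [CountExpr.depth, hf, hm], fun w L hL φ => ?_⟩
    rw [hcard, assignments_empty, Finset.sum_singleton, ← hf' w L hL, ← he w L hL]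
    rfl
  | succ N ih =>
    intro A hs hA hcard
    obtain ⟨x, hx, hxA⟩ : (R \ A).Nonempty := by
      rw [← Set.ncard_pos, hcard]; omega
    obtain ⟨u, hu, v, hv, hvA, huv⟩ := exists_arc_leaving hs hx hxA
    have hunion : R \ A = {v} ∪ R \ insert v A := by
      ext y
      by_cases hy : y = v
      · subst hy; simp [hv, hvA, hR]
      · simp [hy]
    have hdisj : Disjoint {v} (R \ insert v A) := by simp
    obtain ⟨f, hf, hf'⟩ := ih (insert v A) (Or.inr hs) (Set.insert_subset hv hA) (by
      rw [hunion, Set.ncard_union_eq hdisj, Set.ncard_singleton] at hcard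
      omega)
    refine ⟨.outSum d u fun y => .bind v y f,
      CountExpr.depth_outSum_le fun y hy => by simp [CountExpr.depth, hy, hf], fun w L hL φ => ?_⟩
    rw [CountExpr.eval_outSum hL (F := fun y => f.eval w (Function.update φ v y)) fun _ => rfl,
      hunion, sum_assignments_union hdisj, sum_assignments_singleton]
    simp only [hf' w L hL]
    -- Values of `v` that are not out-neighbours of the image of `u` violate the arc `u → v` and
    -- contribute zero.
    refine Finset.sum_subset (fun y hy => ?_) fun y _ hy => Finset.sum_eq_zero fun ψ hψ => ?_
    · exact Finset.mem_range.mpr (hL.lt _ y (by simpa using hy))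
    · have h := (mem_assignments.mp hψ).2
      have huvne : u ≠ v := by rintro rfl; exact hvA hu
      have h1 : ψ u = φ u := by rw [h u (by simp [hu]), Function.update_of_ne huvne]
      have h2 : ψ v = y := by rw [h v (by simp), Function.update_self]
      rw [keptInd, if_neg, zero_mul]
      intro hk
      have := hk u (hA hu) v huv
      rw [h1, h2] at this
      exact hy (by simpa using this)

/-- The one additional level is the sum over the image of the root `s`. -/
theorem exists_expr_of_reach {d m : ℕ} {S : Set V} {s : V} (hs : s ∈ S) {e : CountExpr V}
    (he : CountsExtensions E d (S \ reachIn E S s) e) (hm : e.depth ≤ m) :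
    ∃ f : CountExpr V, f.depth ≤ m + 1 ∧ CountsExtensions E d S f := by
  have hsR : s ∈ reachIn E S s := Relation.ReflTransGen.refl
  obtain ⟨f, hf, hf'⟩ := exists_expr_of_partial_reach he hm _ {s} rfl
    (Set.singleton_subset_iff.mpr hsR) rfl
  refine ⟨.sum s f, by simpa [CountExpr.depth] using hf, fun w L hL φ => ?_⟩
  have h1 := extCount_union (L := L) (n := w 0)
    (Set.disjoint_sdiff_right (s := reachIn E S s) (t := S))
    (fun u hu v hv => not_arc_of_mem_reachIn hs hu hv) φ
  rw [Set.union_sdiff_cancel (reachIn_subset hs)] at h1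
  have h2 : assignments (w 0) (reachIn E S s) φ =
      assignments (w 0) ({s} ∪ reachIn E S s \ {s}) φ := by
    rw [Set.union_sdiff_cancel (Set.singleton_subset_iff.mpr hsR)]
  rw [h1, h2, sum_assignments_union Set.disjoint_sdiff_right, sum_assignments_singleton]
  simp only [CountExpr.eval, hf' w L hL]

theorem HasElimForest.exists_expr (hE : IsAcyclicRel E) (d : ℕ) {S : Set V} {m : ℕ}
    (h : HasElimForest E S m) :
    ∃ e : CountExpr V, e.depth ≤ m ∧ CountsExtensions E d S e := by
  have hempty : CountsExtensions E d (∅ : Set V) (.const 1) := fun w L _ φ => by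
    rw [extCount_empty]; rfl
  induction h with
  | empty m => exact ⟨_, Nat.zero_le _, hempty⟩
  | single S s m hs huniq =>
    refine exists_expr_of_reach hs.1 (e := .const 1) ?_ (Nat.zero_le m)
    rwa [reachIn_eq_of_unique_source hE hs huniq, Set.sdiff_self]
  | disconnected S m _ _ ih =>
    choose e he he' using ih
    have := Fintype.ofFinite (underlyingIn E S).ConnectedComponent
    refine ⟨.prodOver Finset.univ e, CountExpr.depth_prodOver_le fun c _ => he c,
      fun w L hL φ => ?_⟩
    have h := extCount_biUnion (E := E) (L := L) (n := w 0) (componentIn E S)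
      (fun _ _ => componentIn_disjoint) (fun _ _ => componentIn_no_arc) Finset.univ φ
    simp only [Finset.mem_univ, Set.iUnion_true, iUnion_componentIn] at h
    rw [h, CountExpr.eval_prodOver]
    exact Finset.prod_congr rfl fun c _ => he' c w L hL φ
  | root S s m _ hs _ _ ih =>
    obtain ⟨e, he, he'⟩ := ih
    exact exists_expr_of_reach hs.1 he' he

end ElimForest

/-! ### Existence of elimination forests -/

section ExistsForest

variable {V : Type} {E : V → V → Prop}

/-- The rule `disconnected` needs one common bound for all components. -/
theorem HasElimForest.mono {S : Set V} {m : ℕ} (h : HasElimForest E S m) {m' : ℕ}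
    (hm : m ≤ m') : HasElimForest E S m' := by
  induction h generalizing m' with
  | empty m => exact .empty m'
  | single S s m hs huniq =>
    obtain ⟨r, rfl⟩ : ∃ r, m' = r + 1 := ⟨m' - 1, by omega⟩
    exact .single S s r hs huniq
  | disconnected S m hS _ ih => exact .disconnected S m' hS fun c => ih c hm
  | root S s m hS hs hs' _ ih =>
    obtain ⟨r, rfl⟩ : ∃ r, m' = r + 1 := ⟨m' - 1, by omega⟩
    exact .root S s r hS hs hs' (ih (by omega))

/-- Guarantees that the infimum defining `dagTreedepthOfDag` is attained, rather than being the
default `0` of an empty set. -/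
theorem IsAcyclicRel.exists_hasElimForest [Finite V] (hE : IsAcyclicRel E) (S : Set V) :
    ∃ m, HasElimForest E S m := by
  induction hN : S.ncard using Nat.strong_induction_on generalizing S with
  | _ N ih =>
    subst hN
    rcases S.eq_empty_or_nonempty with rfl | hne
    · exact ⟨0, .empty 0⟩
    by_cases hpre : (underlyingIn E S).Preconnected
    · obtain ⟨s, hs, hmin⟩ := hE.wellFounded.has_min S hne
      have hsrc : IsSourceIn E S s := ⟨hs, hmin⟩
      by_cases huniq : ∀ s', IsSourceIn E S s' → s' = s
      · exact ⟨1, .single S s 0 hsrc huniq⟩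
      · push Not at huniq
        have hlt : (S \ reachIn E S s).ncard < S.ncard :=
          Set.ncard_lt_ncard ⟨Set.sdiff_subset, fun h => (h hs).2 Relation.ReflTransGen.refl⟩
        obtain ⟨m, hm⟩ := ih _ hlt _ rfl
        have := hne.to_subtype
        exact ⟨m + 1, .root S s m ⟨hpre⟩ hsrc huniq hm⟩
    · have hc : ∀ c : (underlyingIn E S).ConnectedComponent,
          ∃ m, HasElimForest E (componentIn E S c) m := by
        -- A component that is all of `S` would make the graph preconnected, so components are
        -- strictly smaller.
        refine fun c => ih _ (Set.ncard_lt_ncard ⟨?_, fun h => hpre fun x y => ?_⟩) _ rfl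
        · rintro _ ⟨x, -, rfl⟩
          exact x.2
        · have hmem : ∀ z : S, (underlyingIn E S).connectedComponentMk z = c := by
            intro z
            obtain ⟨z', hz', hzz⟩ := h z.2
            rwa [← Subtype.ext hzz]
          exact SimpleGraph.ConnectedComponent.exact ((hmem x).trans (hmem y).symm)
      choose m hm using hc
      obtain ⟨M, hM⟩ := (Set.finite_range m).bddAbove
      exact ⟨M, .disconnected S M hpre fun c => (hm c).mono (hM ⟨c, rfl⟩)⟩

theorem IsAcyclicOrientation.hasElimForest [Finite V] {H : SimpleGraph V}
    (hE : IsAcyclicOrientation H E) : HasElimForest E Set.univ (dagTreedepth H) := by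
  have h : HasElimForest E Set.univ (dagTreedepthOfDag E) :=
    Nat.sInf_mem (hE.2.exists_hasElimForest Set.univ)
  -- The supremum bounds its members only if the set is bounded; there are finitely many relations
  -- on `V`.
  refine h.mono (le_csSup (Set.Finite.bddAbove ?_) ⟨E, hE, rfl⟩)
  refine (Set.finite_range (dagTreedepthOfDag (V := V))).subset ?_
  rintro _ ⟨F, -, rfl⟩
  exact ⟨F, rfl⟩

end ExistsForest

/-! ### Degenerate graphs have orientations of small outdegree -/

/-- Peel off a vertex of degree at most `d` and rank it below the rest. It is then no higher-ranked
neighbour of any other vertex, so the bounds for the rest persist. -/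
theorem IsDegenerate.exists_rank {V : Type} [Fintype V] [DecidableEq V] {G : SimpleGraph V}
    [DecidableRel G.Adj] {d : ℕ} (hG : IsDegenerate G d) (S : Finset V) :
    ∃ r : V → ℕ, Set.InjOn r S ∧
      ∀ v ∈ S, (S.filter fun u => G.Adj v u ∧ r v < r u).card ≤ d := by
  induction hN : S.card generalizing S with
  | zero =>
    obtain rfl := Finset.card_eq_zero.mp hN
    exact ⟨fun _ => 0, by simp, by simp⟩
  | succ N ih =>
    have hne : S.Nonempty := Finset.card_pos.mp (by omega)
    obtain ⟨v, hv, hdeg⟩ := hG ((⊤ : G.Subgraph).induce S) (by simpa using hne)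
    replace hv : v ∈ S := by simpa using hv
    obtain ⟨r, hinj, hr⟩ := ih (S.erase v) (by rw [Finset.card_erase_of_mem hv]; omega)
    refine ⟨fun u => if u = v then 0 else r u + 1, ?_, fun u hu => ?_⟩
    · intro x hx y hy hxy
      by_cases hxv : x = v <;> by_cases hyv : y = v
      · rw [hxv, hyv]
      · simp [hxv, hyv] at hxy
      · simp [hxv, hyv] at hxy
      · simp only [hxv, hyv, if_false, Nat.add_right_cancel_iff] at hxy
        exact hinj (by simpa [hxv] using hx) (by simpa [hyv] using hy) hxy
    · by_cases huv : u = v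
      · subst huv
        refine le_trans ?_ hdeg
        rw [← Set.ncard_coe_finset]
        refine Set.ncard_le_ncard (fun x hx => ?_) (Set.toFinite _)
        simp only [Finset.coe_filter, Set.mem_ofPred_eq] at hx
        simp [hu, hx.1, hx.2.1]
      · refine le_trans (Finset.card_le_card fun x hx => ?_)
          (hr u (Finset.mem_erase.mpr ⟨huv, hu⟩))
        simp only [Finset.mem_filter, huv, if_false] at hx
        have hxv : x ≠ v := by
          rintro rfl
          simp at hx
        simp only [hxv, if_false] at hx
        simp only [Finset.mem_filter, Finset.mem_erase]
        exact ⟨⟨hxv, hx.1⟩, hx.2.1, by omega⟩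

theorem IsDegenerate.nonempty_hostLists {n d : ℕ} {G : SimpleGraph (Fin n)}
    (hG : IsDegenerate G d) : Nonempty (HostLists G d) := by
  classical
  obtain ⟨r, hinj, hr⟩ := hG.exists_rank Finset.univ
  have hmem : ∀ u v, v ∈ (Finset.univ.filter fun x => G.Adj u x ∧ r u < r x).toList ↔
      G.Adj u v ∧ r u < r v := fun u v => by simp
  refine ⟨⟨fun v => (Finset.univ.filter fun u => G.Adj v u ∧ r v < r u).toList,
    fun v => Finset.nodup_toList _, fun v => by simpa using hr v (Finset.mem_univ v),
    fun u v => ?_, fun v hv => ?_⟩⟩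
  · simp only [hmem]
    refine ⟨fun h => ?_, fun h => h.elim (fun h => h.1) fun h => h.1.symm⟩
    have hne : r u ≠ r v := fun he => h.ne (hinj (by simp) (by simp) he)
    rcases lt_or_gt_of_ne hne with hlt | hlt
    · exact Or.inl ⟨h, hlt⟩
    · exact Or.inr ⟨h.symm, hlt⟩
  · have hlt : ∀ {x y}, Relation.TransGen (fun u v => v ∈
        (Finset.univ.filter fun x => G.Adj u x ∧ r u < r x).toList) x y → r x < r y := by
      intro x y h
      induction h with
      | single h => exact ((hmem _ _).mp h).2
      | tail _ h ih => exact ih.trans ((hmem _ _).mp h).2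
    exact lt_irrefl _ (hlt hv)

/-! ### The input array of a host graph -/

namespace HostLists

variable {n d : ℕ} {G : SimpleGraph (Fin n)} (X : HostLists G d)

/-- The out-neighbour lists as lists of natural numbers. -/
def natOut (x : ℕ) : List ℕ :=
  if h : x < n then (X.out ⟨x, h⟩).map Fin.val else []

theorem mem_natOut (x y : Fin n) : (y : ℕ) ∈ X.natOut x ↔ y ∈ X.out x := by
  simp [natOut, Fin.val_inj]

theorem encodesLists : EncodesLists X.words d X.natOut where
  nodup x := by
    by_cases h : x < n
    · simpa [natOut, h] using (X.nodup _).map Fin.val_injective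
    · simp [natOut, h]
  length_le x := by
    by_cases h : x < n
    · simpa [natOut, h] using X.length_le _
    · simp [natOut, h]
  lt x y hy := by
    by_cases h : x < n
    · simp only [natOut, h, dif_pos, List.mem_map] at hy
      obtain ⟨z, -, rfl⟩ := hy
      exact z.2
    · simp [natOut, h] at hy
  word_length x := by
    have h1 : x * (d + 1) / (d + 1) = x := Nat.mul_div_cancel x (Nat.succ_pos d)
    have h2 : x * (d + 1) % (d + 1) = 0 := Nat.mul_mod_left x (d + 1)
    by_cases h : x < n
    · simp [natOut, words, h1, h2, h]
    -- Beyond the last block the array is zero, matching the empty list.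
    · simp [natOut, words, h1, h]
  word_get x j hj := by
    by_cases h : x < n
    · simp only [natOut, h, dif_pos] at hj ⊢
      have hjd : j + 1 < d + 1 := by
        have := X.length_le ⟨x, h⟩
        simp only [List.length_map] at hj
        omega
      have h1 : (x * (d + 1) + (j + 1)) / (d + 1) = x := by
        rw [mul_comm, Nat.mul_add_div (Nat.succ_pos d), Nat.div_eq_of_lt hjd, add_zero]
      have h2 : (x * (d + 1) + (j + 1)) % (d + 1) = j + 1 := by
        rw [mul_comm, Nat.mul_add_mod, Nat.mod_eq_of_lt hjd]
      rw [show x * (d + 1) + (j + 2) = x * (d + 1) + (j + 1) + 1 from rfl]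
      simp only [words, h1, h2, h, dif_pos, List.getD_eq_getElem?_getD,
        List.getElem?_eq_getElem hj, Option.getD_some]
    · simp [natOut, h] at hj

theorem words_le (i : ℕ) : X.words i ≤ (X.words 0 + 2) ^ (d + 1) := by
  have hn : n ≤ (n + 2) ^ (d + 1) :=
    (Nat.le_add_right n 2).trans (Nat.le_self_pow (by omega) _)
  have hd : d ≤ (n + 2) ^ (d + 1) :=
    calc d ≤ 2 ^ d := Nat.lt_two_pow_self.le
      _ ≤ 2 ^ (d + 1) := Nat.pow_le_pow_right (by omega) (by omega)
      _ ≤ _ := Nat.pow_le_pow_left (by omega) _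
  change X.words i ≤ (n + 2) ^ (d + 1)
  cases i with
  | zero => exact hn
  | succ i =>
    simp only [words]
    split_ifs with h
    · split
      · exact (X.length_le _).trans hd
      · rename_i j _
        refine le_trans ?_ hn
        rw [List.getD_eq_getElem?_getD]
        cases hget : ((X.out ⟨i / (d + 1), h⟩).map Fin.val)[j]? with
        | none => simp
        | some y =>
          obtain ⟨z, -, rfl⟩ := List.mem_map.mp (List.mem_of_getElem? hget)
          exact z.2.le
    · exact Nat.zero_le _

theorem arcsKept_univ_iff {V : Type} (E : V → V → Prop) (f : V → Fin n) :
    ArcsKept E X.natOut Set.univ (fun v => (f v : ℕ)) ↔ ∀ u v, E u v → f v ∈ X.out (f u) := by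
  simp only [ArcsKept, Set.mem_univ, true_imp_iff, X.mem_natOut]

end HostLists

/-! ### Counting homomorphisms -/

section CountHom

variable {V : Type} {n d : ℕ} {G : SimpleGraph (Fin n)}

theorem HostLists.asymm (X : HostLists G d) {x y : Fin n} (h : y ∈ X.out x) : x ∉ X.out y :=
  fun h' => X.orientation.2 x (.tail (.single h) h')

/-- A homomorphism pulls the orientation of the host back to exactly one acyclic orientation. -/
theorem sum_keptInd_eq (X : HostLists G d) (H : SimpleGraph V)
    {O : Finset (V → V → Prop)} (hO : ∀ E, E ∈ O ↔ IsAcyclicOrientation H E) (f : V → Fin n)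
    [Decidable (∀ u v, H.Adj u v → G.Adj (f u) (f v))] :
    ∑ E ∈ O, keptInd E X.natOut Set.univ (fun v => (f v : ℕ)) =
      if ∀ u v, H.Adj u v → G.Adj (f u) (f v) then 1 else 0 := by
  have hadj : ∀ x y, G.Adj x y ↔ y ∈ X.out x ∨ x ∈ X.out y := X.orientation.1
  split_ifs with hf
  -- The pulled-back orientation is acyclic because `f` maps a directed cycle to a closed directed
  -- walk in the host.
  · have hmem : (fun u v => H.Adj u v ∧ f v ∈ X.out (f u)) ∈ O := by
      rw [hO]
      refine ⟨fun u v => ⟨fun h => ?_, ?_⟩, fun v hv => X.orientation.2 (f v)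
        (hv.lift f fun _ _ h => h.2)⟩
      · rcases (hadj _ _).mp (hf u v h) with h' | h'
        · exact Or.inl ⟨h, h'⟩
        · exact Or.inr ⟨h.symm, h'⟩
      · rintro (h | h)
        · exact h.1
        · exact h.1.symm
    rw [Finset.sum_eq_single_of_mem _ hmem, keptInd, if_pos]
    · exact (X.arcsKept_univ_iff _ f).mpr fun u v h => h.2
    · intro E hE hne
      rw [hO] at hE
      rw [keptInd, if_neg]
      intro hk
      rw [X.arcsKept_univ_iff] at hk
      -- An edge oriented by `E` against the pullback would give a directed 2-cycle in the host.
      refine hne (funext₂ fun u v => propext ⟨fun h => ⟨(hE.1 u v).mpr (Or.inl h), hk u v h⟩, ?_⟩)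
      rintro ⟨h, h'⟩
      exact ((hE.1 u v).mp h).resolve_right fun hvu => X.asymm h' (hk v u hvu)
  · refine Finset.sum_eq_zero fun E hE => ?_
    rw [hO] at hE
    rw [keptInd, if_neg]
    intro hk
    rw [X.arcsKept_univ_iff] at hk
    refine hf fun u v h => (hadj _ _).mpr ?_
    exact ((hE.1 u v).mp h).imp (hk u v) (hk v u)

variable [Fintype V] [DecidableEq V]

theorem sum_assignments_univ (n : ℕ) (φ : V → ℕ) (F : (V → ℕ) → ℕ) :
    ∑ ψ ∈ assignments n Set.univ φ, F ψ = ∑ f : V → Fin n, F fun v => f v := by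
  symm
  refine Finset.sum_bij (fun f _ v => (f v : ℕ)) ?_ ?_ ?_ fun _ _ => rfl
  · intro f _
    simp [mem_assignments]
  · intro f _ g _ h
    exact funext fun v => Fin.ext (congrFun h v)
  · intro ψ hψ
    have h := (mem_assignments.mp hψ).1
    exact ⟨fun v => ⟨ψ v, h v trivial⟩, Finset.mem_univ _, rfl⟩

theorem card_hom_eq_sum (X : HostLists G d) (H : SimpleGraph V)
    {O : Finset (V → V → Prop)} (hO : ∀ E, E ∈ O ↔ IsAcyclicOrientation H E) (φ : V → ℕ) :
    Nat.card (H →g G) = ∑ E ∈ O, extCount E X.natOut n Set.univ φ := by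
  classical
  have hequiv : (H →g G) ≃ {f : V → Fin n // ∀ u v, H.Adj u v → G.Adj (f u) (f v)} :=
    { toFun := fun f => ⟨f, fun _ _ h => f.map_rel h⟩
      invFun := fun f => ⟨f.1, fun {u v} h => f.2 u v h⟩
      left_inv := fun _ => rfl
      right_inv := fun _ => rfl }
  simp only [extCount, sum_assignments_univ]
  rw [Finset.sum_comm, Nat.card_congr hequiv, Nat.card_eq_fintype_card, Fintype.card_subtype,
    Finset.card_filter]
  exact Finset.sum_congr rfl fun f _ => (sum_keptInd_eq X H hO f).symm

/-- Homomorphisms from `H` to graphs with orientations of outdegree at most `d` are counted by an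
expression whose depth is the DAG treedepth of `H`. -/
theorem exists_expr_card_hom (d : ℕ) (H : SimpleGraph V) :
    ∃ e : CountExpr V, e.depth ≤ dagTreedepth H ∧
      ∀ (n : ℕ) (G : SimpleGraph (Fin n)) (X : HostLists G d) (φ : V → ℕ),
        e.eval X.words φ = Nat.card (H →g G) := by
  have hfin : {E : V → V → Prop | IsAcyclicOrientation H E}.Finite := Set.toFinite _
  have hO : ∀ E, E ∈ hfin.toFinset ↔ IsAcyclicOrientation H E := fun E => hfin.mem_toFinset
  have hex : ∀ E : V → V → Prop, ∃ e : CountExpr V, E ∈ hfin.toFinset →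
      e.depth ≤ dagTreedepth H ∧ CountsExtensions E d Set.univ e := by
    intro E
    by_cases hE : E ∈ hfin.toFinset
    · obtain ⟨e, he⟩ := ((hO E).mp hE).hasElimForest.exists_expr ((hO E).mp hE).2 d
      exact ⟨e, fun _ => he⟩
    · exact ⟨.const 0, fun h => absurd h hE⟩
  choose e he using hex
  refine ⟨.sumOver hfin.toFinset e, CountExpr.depth_sumOver_le fun E hE => (he E hE).1,
    fun n G X φ => ?_⟩
  rw [CountExpr.eval_sumOver, card_hom_eq_sum X H hO φ]
  exact Finset.sum_congr rfl fun E hE => (he E hE).2 _ _ X.encodesLists φ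

theorem exists_program_card_hom (d : ℕ) (H : SimpleGraph V) :
    ∃ (C s c : ℕ) (P : RamProgram), ∀ (n : ℕ) (G : SimpleGraph (Fin n)) (X : HostLists G d),
      RamComputes P X.words (C * (n ^ dagTreedepth H + 1)) s ((n + 2) ^ c)
        (Nat.card (H →g G)) := by
  obtain ⟨e, hdepth, he⟩ := exists_expr_card_hom d H
  obtain ⟨C, hC⟩ := e.exists_time_le
  refine ⟨C + 1, 1 + e.cells, e.growth (d + 1), e.program, fun n G X => ?_⟩
  rw [← he n G X fun _ => 0]
  refine e.program_computes X.words_le ?_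
  have := hC n _ hdepth
  change e.time n + 1 ≤ _
  rw [add_mul]
  omega

end CountHom

theorem RamComputes.mono {P : RamProgram} {w : ℕ → ℕ} {T s B r T' s' B' : ℕ}
    (h : RamComputes P w T s B r) (hT : T ≤ T') (hs : s ≤ s') (hB : B ≤ B') :
    RamComputes P w T' s' B' r := by
  obtain ⟨h1, h2, h3⟩ := h
  have hrun : ramRun P w T' = ramRun P w T := by
    obtain ⟨j, rfl⟩ : ∃ j, T' = j + T := ⟨T' - T, by omega⟩
    rw [ramRun, Function.iterate_add_apply]
    refine Function.iterate_fixed ?_ j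
    change ramStep P w (ramRun P w T) = ramRun P w T
    rw [ramStep, List.getElem?_eq_none h1]
  refine ⟨by rwa [hrun], by rwa [hrun], fun i a => ⟨(h3 i a).1.trans hB, fun ha => ?_⟩⟩
  exact (h3 i a).2 (hs.trans ha)

theorem theorem1p3 (d k : ℕ) :
    ∃ C s c : ℕ, ∀ (H : SimpleGraph (Fin k)) (t : ℕ), dagTreedepth H = t →
      ∃ P : RamProgram, ∀ (n : ℕ) (G : SimpleGraph (Fin n)), IsDegenerate G d →
        Nonempty (HostLists G d) ∧
        ∀ X : HostLists G d,
          RamComputes P X.words (C * (n ^ t + 1)) s ((n + 2) ^ c) (Nat.card (H →g G)) := by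
  choose C s c P hP using fun H : SimpleGraph (Fin k) => exists_program_card_hom d H
  -- Only finitely many graphs live on `Fin k`, so the constants can be made independent of `H`.
  obtain ⟨C', hC⟩ := (Set.finite_range C).bddAbove
  obtain ⟨s', hs⟩ := (Set.finite_range s).bddAbove
  obtain ⟨c', hc⟩ := (Set.finite_range c).bddAbove
  refine ⟨C', s', c', ?_⟩
  rintro H _ rfl
  refine ⟨P H, fun n G hG => ⟨hG.nonempty_hostLists, fun X => (hP H n G X).mono ?_ (hs ⟨H, rfl⟩) ?_⟩⟩
  · exact Nat.mul_le_mul_right _ (hC ⟨H, rfl⟩)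
  · exact Nat.pow_le_pow_right (by omega) (hc ⟨H, rfl⟩)
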